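/- Let $\mathbb{K}$ be a field and let $\mathcal{S}\subsetneq\mathbb{N}$ be a numerical semigroup, i.e. a proper submonoid of $(\mathbb{N},+)$ with finite complement, with minimal generating set $\{a_1,\ldots,a_m\}$ (the $a_i$ pairwise distinct). The $\mathcal{S}$-degree of a monomial $\mathbf{x}^{\mathbf{u}}\in\mathbb{K}[x_1,\ldots,x_m]$ is $u_1a_1+\cdots+u_ma_m$, and the toric ideal $I_{\mathcal{S}}$ of $\mathcal{S}$ is the ideal generated by all binomials $\mathbf{x}^{\mathbf{u}}-\mathbf{x}^{\mathbf{v}}$ whose two monomials have the same $\mathcal{S}$-degree. A Markov basis of $I_{\mathcal{S}}$ is a minimal (with respect to inclusion) set of binomials $\mathbf{x}^{\mathbf{u}}-\mathbf{x}^{\mathbf{v}}$, $\mathbf{u}\neq\mathbf{v}$, that generates $I_{\mathcal{S}}$; the universal Markov basis is the union of all Markov bases, and the universal Gröbner basis is the union of the reduced Gröbner bases of $I_{\mathcal{S}}$ over all term orders. The Betti elements of $\mathcal{S}$ are the $\mathcal{S}$-degrees of the binomials that occur in a Markov basis of $I_{\mathcal{S}}$. Then the universal Gröbner basis of $I_{\mathcal{S}}$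 equals its universal Markov basis (that is, $I_{\mathcal{S}}$ is generalized robust) if and only if $\mathcal{S}$ has exactly one Betti element. -/

import Mathlib

open MvPolynomial

universe u

/-- `A` is a minimal (with respect to inclusion) generating set of the monoid `S`. -/
def IsMinimalGeneratingSet {M : Type*} [AddCommMonoid M] (S : AddSubmonoid M) (A : Set M) : Prop :=
  Minimal (fun B : Set M => AddSubmonoid.closure B = S) A

/-- A numerical semigroup: a submonoid of `(ℕ, +)` with finite complement. -/
def IsNumericalSemigroup (S : AddSubmonoid ℕ) : Prop :=
  ((S : Set ℕ)ᶜ).Finite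

/-- `f` is a binomial `x ^ u - x ^ v` (with `u ≠ v`). -/
def IsBinomial {σ K : Type*} [Field K] (f : MvPolynomial σ K) : Prop :=
  ∃ u v : σ →₀ ℕ, u ≠ v ∧ f = monomial u 1 - monomial v 1

/-- The toric ideal of the family `a = (a i)`, where the variable `x i` has degree `a i`. The degree
`∑ i, u i • a i` of the monomial `x ^ u` is `Finsupp.weight a u`. -/
noncomputable def toricIdeal {σ M : Type*} [AddCommMonoid M] (K : Type*) [Field K] (a : σ → M) :
    Ideal (MvPolynomial σ K) :=
  Ideal.span {f | ∃ u v : σ →₀ ℕ, Finsupp.weight a u = Finsupp.weight a v ∧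
    f = monomial u 1 - monomial v 1}

/-- `G` is the reduced Gröbner basis of `I` for the term order `ord`: its leading terms generate
the initial ideal of `I`, its elements are monic, and no monomial of an element of `G` is divisible
by the leading monomial of another one. Such a set is automatically finite when there are finitely
many variables. -/
structure IsReducedGroebnerBasis {σ K : Type*} [Field K] (ord : MonomialOrder σ)
    (I : Ideal (MvPolynomial σ K)) (G : Set (MvPolynomial σ K)) : Prop where
  subset : G ⊆ (I : Set (MvPolynomial σ K))
  span_leadingTerm :
    Ideal.span (ord.leadingTerm '' G) = Ideal.span (ord.leadingTerm '' (I : Set (MvPolynomial σ K)))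
  monic : ∀ g ∈ G, ord.leadingCoeff g = 1
  reduced : ∀ g ∈ G, ∀ h ∈ G, h ≠ g → ∀ d ∈ g.support, ¬ ord.degree h ≤ d

/-- The universal Gröbner basis of `I`: the union of all its reduced Gröbner bases, over all term
orders. (A term order on the monomials in `σ` is, up to isomorphism, a `MonomialOrder` whose
synonym type lives in the universe of `σ`.) -/
def universalGroebnerBasis {σ : Type u} {K : Type*} [Field K] (I : Ideal (MvPolynomial σ K)) :
    Set (MvPolynomial σ K) :=
  {f | ∃ (ord : MonomialOrder.{u, u} σ) (G : Set (MvPolynomial σ K)),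
    IsReducedGroebnerBasis ord I G ∧ f ∈ G}

/-- A Markov basis of `I`: a minimal (with respect to inclusion) set of binomials generating `I`. -/
def IsMarkovBasis {σ K : Type*} [Field K] (I : Ideal (MvPolynomial σ K))
    (B : Set (MvPolynomial σ K)) : Prop :=
  Minimal (fun C : Set (MvPolynomial σ K) => (∀ f ∈ C, IsBinomial f) ∧ Ideal.span C = I) B

/-- The universal Markov basis of `I`: the union of all its Markov bases. -/
def universalMarkovBasis {σ K : Type*} [Field K] (I : Ideal (MvPolynomial σ K)) :
    Set (MvPolynomial σ K) :=
  {f | ∃ B : Set (MvPolynomial σ K), IsMarkovBasis I B ∧ f ∈ B}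

/-- `I` is generalized robust: its universal Gröbner basis is its universal Markov basis. -/
def IsGeneralizedRobust {σ : Type u} {K : Type*} [Field K] (I : Ideal (MvPolynomial σ K)) : Prop :=
  universalGroebnerBasis I = universalMarkovBasis I

/-- The Betti elements of the monoid with minimal generators `a i`: the degrees (for the grading
where `x i` has degree `a i`) of the binomials in a Markov basis of the toric ideal of `a`. -/
def bettiElements {σ M : Type*} [AddCommMonoid M] (K : Type*) [Field K] (a : σ → M) : Set M :=
  {b | ∃ B : Set (MvPolynomial σ K), IsMarkovBasis (toricIdeal K a) B ∧
    ∃ f ∈ B, IsWeightedHomogeneous a f b}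

/-- The degrees of all the binomials in a Markov basis coincide. -/
def HasUniqueBettiElement {σ M : Type*} [AddCommMonoid M] (K : Type*) [Field K] (a : σ → M) :
    Prop :=
  ∃! b : M, b ∈ bettiElements K a

/-! Write `I` for the toric ideal and `m` for `idealOfVars`. The generators are positive, at least
two in number, and have gcd 1. Both bases have an intrinsic description. By a graded Nakayama lemma,
a binomial of `I` occurs in a Markov basis iff it lies outside `m * I`
(`mem_universalMarkovBasis_iff`). For a term order, the standard monomials are those smallest in
their weight fiber, so the reduced Gröbner basis consists of the `x^u - x^v` with `v` standard and
`u` minimal nonstandard (`mem_universalGroebnerBasis_iff`). Elimination orders show that every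
circuit `x_i^c - x_j^d` is among these.

If `I` is generalized robust, circuits lie outside `m * I`. Among the three lcms of pairs from `a i,
a j, a k`, a unique maximum would put a circuit into `m * I`. A unique minimum would give a Markov
binomial with a monomial properly divisible by two monomials of equal weight, impossible in a
Gröbner binomial. So all pairwise lcms equal one `b`, and a divisibility argument
(`IsReducedPair.weight_eq_of_lcm_eq`) puts all Gröbner binomials in weight `b`.

Conversely, a unique Betti element `b` puts `I` into the ideal generated by the monomials of weight
`b`, and `m * I` into weights above `b`. Again all lcms equal `b`, and the monomials of weight `b`
are pure powers. So Markov binomials are circuits, while Gröbner binomials have weight `b` and thus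
avoid `m * I`. -/

/-! ### Binomials and weights in the toric ideal. -/

section ToricIdeal

variable {σ K : Type*} [Field K] {a : σ → ℕ}

theorem binomial_mem_toricIdeal {u v : σ →₀ ℕ} (h : Finsupp.weight a u = Finsupp.weight a v) :
    (monomial u 1 - monomial v 1 : MvPolynomial σ K) ∈ toricIdeal K a :=
  Ideal.subset_span ⟨u, v, h, rfl⟩

theorem aeval_X_pow_monomial (u : σ →₀ ℕ) (c : K) :
    aeval (fun i => (Polynomial.X : Polynomial K) ^ a i) (monomial u c) =
      Polynomial.monomial (Finsupp.weight a u) c := by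
  rw [aeval_monomial, ← Polynomial.C_mul_X_pow_eq_monomial, Finsupp.weight_apply, Finsupp.sum,
    Finsupp.prod, ← Finset.prod_pow_eq_pow_sum]
  simp [← pow_mul, mul_comm]

theorem aeval_X_pow_eq_zero_of_mem_toricIdeal {f : MvPolynomial σ K} (hf : f ∈ toricIdeal K a) :
    aeval (fun i => (Polynomial.X : Polynomial K) ^ a i) f = 0 := by
  have : toricIdeal K a ≤ RingHom.ker (aeval (fun i => (Polynomial.X : Polynomial K) ^ a i)) := by
    refine Ideal.span_le.2 ?_
    rintro _ ⟨u, v, h, rfl⟩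
    simp only [SetLike.mem_coe, RingHom.mem_ker, map_sub]
    rw [aeval_X_pow_monomial, aeval_X_pow_monomial, h, sub_self]
  exact this hf

/-- A monomial of an element of the toric ideal has to cancel against another one of the same
weight. -/
theorem exists_ne_mem_support_of_mem_toricIdeal {f : MvPolynomial σ K} (hf : f ∈ toricIdeal K a)
    {d : σ →₀ ℕ} (hd : d ∈ f.support) :
    ∃ e ∈ f.support, e ≠ d ∧ Finsupp.weight a e = Finsupp.weight a d := by
  by_contra! h
  have h0 := aeval_X_pow_eq_zero_of_mem_toricIdeal hf
  rw [f.as_sum, map_sum] at h0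
  simp_rw [aeval_X_pow_monomial] at h0
  have h1 := congrArg (fun p => p.coeff (Finsupp.weight a d)) h0
  simp only [Polynomial.finsetSum_coeff, Polynomial.coeff_monomial, Polynomial.coeff_zero] at h1
  rw [Finset.sum_eq_single d (fun e he hne => if_neg (h e he hne)) (fun hn => absurd hd hn),
    if_pos rfl] at h1
  exact mem_support_iff.1 hd h1

theorem support_binomial [DecidableEq σ] {u v : σ →₀ ℕ} (h : u ≠ v) :
    (monomial u 1 - monomial v 1 : MvPolynomial σ K).support = {u, v} := by
  ext d
  simp only [mem_support_iff, coeff_sub, coeff_monomial, Finset.mem_insert, Finset.mem_singleton]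
  by_cases h1 : u = d
  · subst h1; simp [h.symm]
  · by_cases h2 : v = d
    · subst h2; simp [h]
    · simp [h1, h2, Ne.symm h1, Ne.symm h2]

theorem binomial_ne_zero {u v : σ →₀ ℕ} (h : u ≠ v) :
    (monomial u 1 - monomial v 1 : MvPolynomial σ K) ≠ 0 :=
  sub_ne_zero.2 fun h' => h (monomial_left_injective one_ne_zero h')

theorem weight_eq_of_binomial_mem_toricIdeal {u v : σ →₀ ℕ}
    (h : (monomial u 1 - monomial v 1 : MvPolynomial σ K) ∈ toricIdeal K a) :
    Finsupp.weight a u = Finsupp.weight a v := by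
  classical
  by_cases huv : u = v
  · rw [huv]
  obtain ⟨e, he, hne, hw⟩ := exists_ne_mem_support_of_mem_toricIdeal h (d := u)
    (by simp [support_binomial huv])
  rw [support_binomial huv] at he
  simp only [Finset.mem_insert, Finset.mem_singleton, hne, false_or] at he
  rw [← hw, he]

theorem binomial_eq_binomial {u v s t : σ →₀ ℕ} (h : u ≠ v)
    (heq : (monomial u 1 - monomial v 1 : MvPolynomial σ K) = monomial s 1 - monomial t 1) :
    (u = s ∧ v = t) ∨ (u = t ∧ v = s) := by
  classical
  have hst : s ≠ t := by
    rintro rfl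
    exact binomial_ne_zero h (by rw [heq, sub_self])
  have hs := support_binomial (K := K) h
  rw [heq, support_binomial hst] at hs
  have h1 : u ∈ ({s, t} : Finset _) := by rw [hs]; simp
  have h2 : v ∈ ({s, t} : Finset _) := by rw [hs]; simp
  simp only [Finset.mem_insert, Finset.mem_singleton] at h1 h2
  rcases h1 with rfl | rfl <;> rcases h2 with rfl | rfl <;> simp_all

theorem isWeightedHomogeneous_binomial {u v : σ →₀ ℕ} {n : ℕ} (hu : Finsupp.weight a u = n)
    (hv : Finsupp.weight a v = n) :
    IsWeightedHomogeneous a (monomial u 1 - monomial v 1 : MvPolynomial σ K) n :=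
  Submodule.sub_mem (weightedHomogeneousSubmodule K a n)
    (isWeightedHomogeneous_monomial a u 1 hu) (isWeightedHomogeneous_monomial a v 1 hv)

theorem weight_eq_zero_iff (ha : ∀ i, 0 < a i) {u : σ →₀ ℕ} : Finsupp.weight a u = 0 ↔ u = 0 := by
  refine ⟨fun h => ?_, fun h => by rw [h, map_zero]⟩
  rw [Finsupp.weight_apply, Finsupp.sum, Finset.sum_eq_zero_iff] at h
  ext i
  by_contra hi
  have := h i (by simpa using hi)
  simp only [smul_eq_mul, mul_eq_zero] at this
  exact this.elim hi (ha i).ne'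

end ToricIdeal

/-! ### Graded Nakayama lemma. -/

section Nakayama

variable {σ K : Type*} [Field K] {a : σ → ℕ}

theorem mem_idealOfVars_iff {h : MvPolynomial σ K} : h ∈ idealOfVars σ K ↔ coeff 0 h = 0 := by
  rw [← pow_one (idealOfVars σ K), mem_pow_idealOfVars_iff']
  simp [Finsupp.degree_eq_zero_iff]

/-- As weights are positive, only the constant coefficient of `h` could contribute in weight `n`,
and it vanishes. -/
theorem weightedHomogeneousComponent_mul_eq_zero (ha : ∀ i, 0 < a i) {h f : MvPolynomial σ K}
    {n : ℕ} (hh : h ∈ idealOfVars σ K) (hf : IsWeightedHomogeneous a f n) :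
    weightedHomogeneousComponent a n (h * f) = 0 := by
  classical
  ext d
  rw [coeff_weightedHomogeneousComponent, coeff_zero]
  split_ifs with hd
  · rw [coeff_mul]
    refine Finset.sum_eq_zero fun x hx => ?_
    rw [Finset.HasAntidiagonal.mem_antidiagonal] at hx
    by_cases hy : coeff x.2 f = 0
    · rw [hy, mul_zero]
    · have h2 := hf hy
      rw [← hx, map_add, h2] at hd
      rw [(weight_eq_zero_iff ha).1 (by omega : Finsupp.weight a x.1 = 0),
        mem_idealOfVars_iff.1 hh, zero_mul]
  · rfl

/-- A graded version of Nakayama's lemma: a homogeneous element that is not needed modulo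
`idealOfVars σ K * I` is not needed as a generator of `I`. -/
theorem mem_span_of_mem_idealOfVars_mul_sup (ha : ∀ i, 0 < a i) {C : Set (MvPolynomial σ K)}
    (hC : ∀ g ∈ C, ∃ n, IsWeightedHomogeneous a g n) {f : MvPolynomial σ K} {n : ℕ}
    (hf : IsWeightedHomogeneous a f n)
    (h : f ∈ idealOfVars σ K * Ideal.span (insert f C) ⊔ Ideal.span C) : f ∈ Ideal.span C := by
  classical
  have h1 : f ∈ Ideal.span C ⊔ idealOfVars σ K * Ideal.span {f} := by
    refine (sup_le ?_ le_sup_left : _ ≤ Ideal.span C ⊔ idealOfVars σ K * Ideal.span {f}) h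
    rw [Ideal.span_insert, Ideal.mul_sup, sup_comm]
    exact sup_le_sup_right Ideal.mul_le_right _
  obtain ⟨p, hp, q, hq, hpq⟩ := Submodule.mem_sup.1 h1
  obtain ⟨r, hr, rfl⟩ := Ideal.mem_mul_span_singleton.1 hq
  let := weightedGradedAlgebra K a
  have hhom : (Ideal.span C).IsHomogeneous (weightedHomogeneousSubmodule K a) :=
    Ideal.homogeneous_span _ _ fun g hg => hC g hg
  have h2 := hhom n hp
  -- `p = f - r * f` lies in a homogeneous ideal, and its weight `n` part is `f`.
  rw [eq_sub_of_add_eq hpq] at h2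
  rw [show (((DirectSum.decompose (weightedHomogeneousSubmodule K a)) (f - r * f)) n :
      MvPolynomial σ K) = weightedHomogeneousComponent a n (f - r * f) from
      weightedDecomposition.decompose'_apply K a _ n, map_sub,
    weightedHomogeneousComponent_mul_eq_zero ha hr hf, sub_zero,
    hf.weightedHomogeneousComponent_same] at h2
  exact h2

end Nakayama

/-! ### The universal Markov basis as the binomials outside `m * I`. -/

section Markov

variable {σ K : Type*} [Field K] {a : σ → ℕ}

theorem exists_weight_of_isBinomial_of_mem {f : MvPolynomial σ K} (hf : IsBinomial f)
    (hI : f ∈ toricIdeal K a) : ∃ n, IsWeightedHomogeneous a f n := by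
  obtain ⟨u, v, -, rfl⟩ := hf
  exact ⟨_, isWeightedHomogeneous_binomial (weight_eq_of_binomial_mem_toricIdeal hI) rfl⟩

theorem IsMarkovBasis.notMem_idealOfVars_mul (ha : ∀ i, 0 < a i) {B : Set (MvPolynomial σ K)}
    (hB : IsMarkovBasis (toricIdeal K a) B) {f : MvPolynomial σ K} (hf : f ∈ B) :
    f ∉ idealOfVars σ K * toricIdeal K a := by
  intro h
  have hBI : ∀ g ∈ B, g ∈ toricIdeal K a := fun g hg => hB.1.2 ▸ Ideal.subset_span hg
  obtain ⟨n, hn⟩ := exists_weight_of_isBinomial_of_mem (hB.1.1 f hf) (hBI f hf)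
  have hins : insert f (B \ {f}) = B := by simp [Set.insert_eq_of_mem hf]
  have h1 : f ∈ Ideal.span (B \ {f}) := by
    refine mem_span_of_mem_idealOfVars_mul_sup ha
      (fun g hg => exists_weight_of_isBinomial_of_mem (hB.1.1 g hg.1) (hBI g hg.1)) hn ?_
    rw [hins, hB.1.2]
    exact Ideal.mem_sup_left h
  have h2 : Ideal.span (B \ {f}) = toricIdeal K a := by
    rw [← hB.1.2]
    refine le_antisymm (Ideal.span_mono Set.sdiff_subset) ?_
    conv_lhs => rw [← hins]
    exact Ideal.span_le.2 (Set.insert_subset h1 Ideal.subset_span)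
  exact (hB.2 ⟨fun g hg => hB.1.1 g hg.1, h2⟩ Set.sdiff_subset hf).2 rfl

/-- Steinitz exchange modulo `m * I`: when `f` is written as a combination of `D`, some coefficient
has a nonzero constant term, since otherwise `f` would lie in `m * I`. The relation can then be
solved for that generator. -/
theorem exists_mem_span_diff_sup_of_mem_span {I : Ideal (MvPolynomial σ K)}
    {D : Set (MvPolynomial σ K)} (hD : D ⊆ I) {f : MvPolynomial σ K} (hf : f ∈ Ideal.span D)
    (hfI : f ∉ idealOfVars σ K * I) :
    ∃ g ∈ D, g ∈ idealOfVars σ K * I ⊔ Ideal.span (insert f (D \ {g})) := by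
  classical
  obtain ⟨c, hcD, hc⟩ := Submodule.mem_span_set.1 hf
  by_cases hall : ∀ g ∈ c.support, c g ∈ idealOfVars σ K
  · refine absurd ?_ hfI
    rw [← hc]
    exact Submodule.sum_mem _ fun g hg => Ideal.mul_mem_mul (hall g hg) (hD (hcD hg))
  push Not at hall
  obtain ⟨g, hg, hgm⟩ := hall
  refine ⟨g, hcD hg, ?_⟩
  set J := idealOfVars σ K * I ⊔ Ideal.span (insert f (D \ {g}))
  set κ := coeff 0 (c g)
  have hκ : κ ≠ 0 := fun h => hgm (mem_idealOfVars_iff.2 h)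
  have hfJ : f ∈ J := Ideal.mem_sup_right (Ideal.subset_span (Set.mem_insert _ _))
  have hsum : ∑ x ∈ c.support.erase g, c x * x ∈ J := by
    refine Submodule.sum_mem _ fun x hx => J.mul_mem_left _ (Ideal.mem_sup_right
      (Ideal.subset_span (Set.mem_insert_of_mem _ ⟨hcD (Finset.mem_of_mem_erase hx), ?_⟩)))
    exact Finset.ne_of_mem_erase hx
  have hm : (c g - C κ) * g ∈ J :=
    Ideal.mem_sup_left (Ideal.mul_mem_mul (mem_idealOfVars_iff.2 (by simp [κ])) (hD (hcD hg)))
  have hk : C κ * g ∈ J := by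
    have : C κ * g = f - ∑ x ∈ c.support.erase g, c x * x - (c g - C κ) * g := by
      rw [← hc, Finsupp.sum, ← Finset.add_sum_erase _ _ hg]
      simp only [smul_eq_mul]
      ring
    rw [this]
    exact J.sub_mem (J.sub_mem hfJ hsum) hm
  have := J.mul_mem_left (C κ⁻¹) hk
  rwa [← mul_assoc, ← C_mul, inv_mul_cancel₀ hκ, C_1, one_mul] at this

theorem exists_finite_binomials_span_eq [Finite σ] :
    ∃ T : Set (MvPolynomial σ K), T.Finite ∧ (∀ f ∈ T, IsBinomial f) ∧
      Ideal.span T = toricIdeal K a := by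
  have hfg : (toricIdeal K a).FG := IsNoetherian.noetherian _
  obtain ⟨T, hT, hspan⟩ := (Submodule.fg_span_iff_fg_span_finset_subset _).1 hfg
  refine ⟨(T : Set _) \ {0}, T.finite_toSet.subset Set.sdiff_subset, ?_, ?_⟩
  · rintro f ⟨hfT, hf0⟩
    obtain ⟨u, v, -, rfl⟩ := hT hfT
    refine ⟨u, v, ?_, rfl⟩
    rintro rfl
    simp at hf0
  · rw [Ideal.span_sdiff_singleton_zero]
    exact hspan.symm

theorem mem_universalMarkovBasis_iff [Finite σ] (ha : ∀ i, 0 < a i) {f : MvPolynomial σ K} :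
    f ∈ universalMarkovBasis (toricIdeal K a) ↔
      IsBinomial f ∧ f ∈ toricIdeal K a ∧ f ∉ idealOfVars σ K * toricIdeal K a := by
  constructor
  · rintro ⟨B, hB, hf⟩
    exact ⟨hB.1.1 f hf, hB.1.2 ▸ Ideal.subset_span hf, hB.notMem_idealOfVars_mul ha hf⟩
  · rintro ⟨hbin, hI, hnot⟩
    obtain ⟨T, hTfin, hTbin, hTspan⟩ := exists_finite_binomials_span_eq (K := K) (a := a)
    -- Minimizing only among generating sets that contain `f` keeps `f` in the result; that `f` is
    -- itself irredundant is shown separately.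
    let P : Set (MvPolynomial σ K) → Prop := fun B =>
      B ⊆ insert f T ∧ f ∈ B ∧ Ideal.span B = toricIdeal K a
    have hP : P (insert f T) := by
      refine ⟨le_rfl, Set.mem_insert _ _, ?_⟩
      rw [Ideal.span_insert, hTspan, sup_eq_right, Ideal.span_singleton_le_iff_mem]
      exact hI
    have hfin : {B | P B}.Finite :=
      (hTfin.insert f).finite_subsets.subset fun B hB => hB.1
    obtain ⟨B, -, hBmin⟩ := hfin.exists_le_minimal hP
    obtain ⟨hBT, hfB, hBspan⟩ := hBmin.1
    have hBbin : ∀ g ∈ B, IsBinomial g := fun g hg =>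
      (hBT hg).elim (fun h => h ▸ hbin) (hTbin g)
    have hBI : ∀ g ∈ B, g ∈ toricIdeal K a := fun g hg => hBspan ▸ Ideal.subset_span hg
    -- an element other than `f` cannot be removed
    have key : ∀ g ∈ B, g ≠ f → g ∉ Ideal.span (B \ {g}) := by
      intro g hg hgf hmem
      have : P (B \ {g}) := by
        refine ⟨Set.sdiff_subset.trans hBT, ⟨hfB, Ne.symm hgf⟩, le_antisymm ?_ ?_⟩
        · exact hBspan ▸ Ideal.span_mono Set.sdiff_subset
        · rw [← hBspan, Ideal.span_le]
          intro x hx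
          by_cases hxg : x = g
          · exact hxg ▸ hmem
          · exact Ideal.subset_span ⟨hx, hxg⟩
      exact (hBmin.2 this Set.sdiff_subset hg).2 rfl
    -- If `f` were redundant, exchange would make some `g ≠ f` redundant modulo `m * I`, hence
    -- redundant by Nakayama, contradicting `key`.
    have keyf : f ∉ Ideal.span (B \ {f}) := by
      intro hmem
      obtain ⟨g, hg, hgJ⟩ := exists_mem_span_diff_sup_of_mem_span
        (I := toricIdeal K a) (fun x hx => hBI x hx.1) hmem hnot
      have hset : insert f ((B \ {f}) \ {g}) = B \ {g} := by
        ext x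
        simp only [Set.mem_insert_iff, Set.mem_sdiff, Set.mem_singleton_iff]
        constructor
        · rintro (rfl | h)
          · exact ⟨hfB, Ne.symm hg.2⟩
          · exact ⟨h.1.1, h.2⟩
        · intro h
          by_cases hxf : x = f
          · exact Or.inl hxf
          · exact Or.inr ⟨⟨h.1, hxf⟩, h.2⟩
      obtain ⟨n, hn⟩ := exists_weight_of_isBinomial_of_mem (hBbin g hg.1) (hBI g hg.1)
      refine key g hg.1 hg.2 (mem_span_of_mem_idealOfVars_mul_sup ha
        (fun x hx => exists_weight_of_isBinomial_of_mem (hBbin x hx.1) (hBI x hx.1)) hn ?_)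
      have hins : insert g (B \ {g}) = B := by simp [Set.insert_eq_of_mem hg.1]
      rwa [hins, hBspan, ← hset]
    refine ⟨B, ⟨⟨hBbin, hBspan⟩, ?_⟩, hfB⟩
    rintro D ⟨-, hDspan⟩ hDB g hg
    by_contra hgD
    have hgspan : g ∈ Ideal.span (B \ {g}) :=
      Ideal.span_mono (fun x hx => ⟨hDB hx, fun h => hgD (h ▸ hx)⟩ : D ⊆ B \ {g})
        (hDspan ▸ hBI g hg)
    by_cases hgf : g = f
    · exact keyf (hgf ▸ hgspan)
    · exact key g hg hgf hgspan

end Markov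

/-! ### Standard monomials as minima of weight fibers. -/

section FiberMinimal

variable {σ : Type*}

/-- The monomial `x ^ v` is the smallest one of its weight, for the term order `ord`. -/
def IsFiberMinimal (ord : MonomialOrder σ) (a : σ → ℕ) (v : σ →₀ ℕ) : Prop :=
  ∀ u, Finsupp.weight a u = Finsupp.weight a v → ord.toSyn v ≤ ord.toSyn u

variable {ord : MonomialOrder σ} {a : σ → ℕ}

theorem IsFiberMinimal.of_le {u v : σ →₀ ℕ} (hv : IsFiberMinimal ord a v) (h : u ≤ v) :
    IsFiberMinimal ord a u := by
  obtain ⟨t, rfl⟩ := exists_add_of_le h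
  intro s hs
  have := hv (s + t) (by rw [map_add, map_add, hs])
  rwa [map_add, map_add, add_le_add_iff_right] at this

theorem IsFiberMinimal.eq {u v : σ →₀ ℕ} (hu : IsFiberMinimal ord a u)
    (hv : IsFiberMinimal ord a v) (h : Finsupp.weight a u = Finsupp.weight a v) : u = v :=
  ord.toSyn.injective (le_antisymm (hu v h.symm) (hv u h))

theorem exists_isFiberMinimal (ord : MonomialOrder σ) (a : σ → ℕ) (u : σ →₀ ℕ) :
    ∃ v, Finsupp.weight a v = Finsupp.weight a u ∧ IsFiberMinimal ord a v := by
  obtain ⟨x, ⟨v, hv, rfl⟩, hmin⟩ := wellFounded_lt.has_min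
    (ord.toSyn '' {v | Finsupp.weight a v = Finsupp.weight a u}) ⟨_, u, rfl, rfl⟩
  exact ⟨v, hv, fun s hs => not_lt.1 (hmin _ ⟨s, hs.trans hv, rfl⟩)⟩

theorem IsFiberMinimal.lt {u v : σ →₀ ℕ} (hv : IsFiberMinimal ord a v)
    (h : Finsupp.weight a u = Finsupp.weight a v) (hne : u ≠ v) : ord.toSyn v < ord.toSyn u :=
  lt_of_le_of_ne (hv u h) fun h' => hne (ord.toSyn.injective h'.symm)

end FiberMinimal

/-! ### Reduced Gröbner bases of the toric ideal. -/

section Groebner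

variable {σ K : Type*} [Field K] {ord : MonomialOrder σ} {a : σ → ℕ}

theorem not_isFiberMinimal_degree {f : MvPolynomial σ K} (hf : f ∈ toricIdeal K a) (h0 : f ≠ 0) :
    ¬ IsFiberMinimal ord a (ord.degree f) := by
  intro h
  obtain ⟨e, he, hne, hw⟩ := exists_ne_mem_support_of_mem_toricIdeal hf (ord.degree_mem_support h0)
  exact (h.lt hw hne).not_ge (ord.le_degree he)

theorem exists_mem_support_not_isFiberMinimal {f : MvPolynomial σ K} (hf : f ∈ toricIdeal K a)
    (h0 : f ≠ 0) : ∃ d ∈ f.support, ¬ IsFiberMinimal ord a d :=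
  ⟨_, ord.degree_mem_support h0, not_isFiberMinimal_degree hf h0⟩

theorem degree_binomial {u v : σ →₀ ℕ} (h : ord.toSyn v < ord.toSyn u) :
    ord.degree (monomial u 1 - monomial v 1 : MvPolynomial σ K) = u := by
  classical
  rw [ord.degree_sub_of_lt] <;> simp [ord.degree_monomial, h]

theorem leadingCoeff_binomial {u v : σ →₀ ℕ} (h : ord.toSyn v < ord.toSyn u) :
    ord.leadingCoeff (monomial u 1 - monomial v 1 : MvPolynomial σ K) = 1 := by
  classical
  rw [ord.leadingCoeff_sub_of_lt] <;> simp [ord.degree_monomial, h]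

theorem span_leadingTerm_eq_iff {I : Ideal (MvPolynomial σ K)} {G : Set (MvPolynomial σ K)}
    (hG : G ⊆ I) :
    Ideal.span (ord.leadingTerm '' G) =
        Ideal.span (ord.leadingTerm '' (I : Set (MvPolynomial σ K))) ↔
      ∀ f ∈ I, f ≠ 0 → ∃ g ∈ G, g ≠ 0 ∧ ord.degree g ≤ ord.degree f := by
  classical
  have key : ∀ f : MvPolynomial σ K, f ≠ 0 →
      (monomial (ord.degree f) (1 : K) ∈ Ideal.span (ord.leadingTerm '' G) ↔
        ∃ g ∈ G, g ≠ 0 ∧ ord.degree g ≤ ord.degree f) := by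
    intro f hf
    rw [ord.span_leadingTerm_eq_span_monomial', ← Set.image_image (fun s => monomial s (1 : K)),
      mem_ideal_span_monomial_image]
    simp [support_monomial, and_assoc]
  constructor
  · intro h f hf h0
    rw [← key f h0, h, ord.span_leadingTerm_eq_span_monomial']
    exact Ideal.subset_span ⟨f, ⟨hf, h0⟩, rfl⟩
  · intro h
    refine le_antisymm (Ideal.span_mono (Set.image_mono hG)) ?_
    conv_lhs => rw [ord.span_leadingTerm_eq_span_monomial']
    rw [Ideal.span_le]
    rintro _ ⟨f, ⟨hf, h0⟩, rfl⟩
    exact (key f h0).2 (h f hf h0)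

/-- `x ^ u - x ^ v` is the binomial of the reduced Gröbner basis for `ord` with leading monomial
`x ^ u`. -/
def IsReducedPair (ord : MonomialOrder σ) (a : σ → ℕ) (u v : σ →₀ ℕ) : Prop :=
  u ≠ v ∧ Finsupp.weight a u = Finsupp.weight a v ∧ IsFiberMinimal ord a v ∧
    ∀ s < u, IsFiberMinimal ord a s

theorem IsReducedPair.not_isFiberMinimal {u v : σ →₀ ℕ} (h : IsReducedPair ord a u v) :
    ¬ IsFiberMinimal ord a u := fun h' => h.1 (h'.eq h.2.2.1 h.2.1)

theorem IsReducedPair.lt {u v : σ →₀ ℕ} (h : IsReducedPair ord a u v) :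
    ord.toSyn v < ord.toSyn u :=
  h.2.2.1.lt h.2.1 h.1

theorem exists_isReducedPair_le {d : σ →₀ ℕ} (hd : ¬ IsFiberMinimal ord a d) :
    ∃ u v, IsReducedPair ord a u v ∧ u ≤ d := by
  -- Proper divisors are smaller in the term order, so a minimum for the order is also minimal for
  -- divisibility.
  obtain ⟨x, ⟨u, ⟨hud, hu⟩, rfl⟩, hmin⟩ := wellFounded_lt.has_min
    (ord.toSyn '' {u | u ≤ d ∧ ¬ IsFiberMinimal ord a u}) ⟨_, d, ⟨le_rfl, hd⟩, rfl⟩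
  obtain ⟨v, hv, hvm⟩ := exists_isFiberMinimal ord a u
  refine ⟨u, v, ⟨?_, hv.symm, hvm, fun s hs => ?_⟩, hud⟩
  · rintro rfl
    exact hu hvm
  · by_contra h
    exact hmin _ ⟨s, ⟨hs.le.trans hud, h⟩, rfl⟩ (ord.toSyn_strictMono hs)

theorem isReducedGroebnerBasis_toricIdeal (ord : MonomialOrder σ) (a : σ → ℕ) :
    IsReducedGroebnerBasis ord (toricIdeal K a)
      {f | ∃ u v, IsReducedPair ord a u v ∧ f = monomial u 1 - monomial v 1} := by
  classical
  have hsub : {f : MvPolynomial σ K | ∃ u v, IsReducedPair ord a u v ∧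
      f = monomial u 1 - monomial v 1} ⊆ toricIdeal K a := by
    rintro _ ⟨u, v, h, rfl⟩
    exact binomial_mem_toricIdeal h.2.1
  refine ⟨hsub, (span_leadingTerm_eq_iff hsub).2 fun f hf h0 => ?_, ?_, ?_⟩
  · obtain ⟨u, v, h, hle⟩ := exists_isReducedPair_le (not_isFiberMinimal_degree (ord := ord) hf h0)
    exact ⟨_, ⟨u, v, h, rfl⟩, binomial_ne_zero h.1, by rwa [degree_binomial h.lt]⟩
  · rintro _ ⟨u, v, h, rfl⟩
    exact leadingCoeff_binomial h.lt
  · rintro _ ⟨u, v, h, rfl⟩ _ ⟨s, t, h', rfl⟩ hne d hd hle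
    rw [degree_binomial h'.lt] at hle
    rw [support_binomial h.1, Finset.mem_insert, Finset.mem_singleton] at hd
    rcases hd with rfl | rfl
    · rcases hle.eq_or_lt with rfl | hlt
      · rw [h'.2.2.1.eq h.2.2.1 (h'.2.1.symm.trans h.2.1)] at hne
        exact hne rfl
      · exact h'.not_isFiberMinimal (h.2.2.2 s hlt)
    · exact h'.not_isFiberMinimal (h.2.2.1.of_le hle)

/-- Reducedness makes `u = ord.degree g` a minimal nonstandard monomial; let `v` be the minimum of
its fiber. If `g` differed from `x^u - x^v`, the difference would be a nonzero element of `I` and so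
contain a nonstandard monomial. That monomial is neither `u` nor `v`, so it occurs in `g`, against
reducedness. -/
theorem IsReducedGroebnerBasis.exists_isReducedPair {G : Set (MvPolynomial σ K)}
    (hG : IsReducedGroebnerBasis ord (toricIdeal K a) G) {g : MvPolynomial σ K} (hg : g ∈ G) :
    ∃ u v, IsReducedPair ord a u v ∧ g = monomial u 1 - monomial v 1 := by
  classical
  have hlead := (span_leadingTerm_eq_iff hG.subset).1 hG.span_leadingTerm
  have hg0 : g ≠ 0 := by
    rintro rfl
    simpa using hG.monic 0 hg
  have hgI : g ∈ toricIdeal K a := hG.subset hg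
  -- a monomial that is not minimal in its fiber is divisible by a leading monomial of `G`
  have hdiv : ∀ d, ¬ IsFiberMinimal ord a d → ∃ h ∈ G, ord.degree h ≤ d := by
    intro d hd
    obtain ⟨u, v, h, hle⟩ := exists_isReducedPair_le hd
    obtain ⟨p, hp, -, hpu⟩ := hlead _ (binomial_mem_toricIdeal h.2.1) (binomial_ne_zero h.1)
    rw [degree_binomial h.lt] at hpu
    exact ⟨p, hp, hpu.trans hle⟩
  obtain ⟨v, hv, hvm⟩ := exists_isFiberMinimal ord a (ord.degree g)
  have hred : IsReducedPair ord a (ord.degree g) v := by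
    refine ⟨?_, hv.symm, hvm, fun s hs => ?_⟩
    · intro h
      exact not_isFiberMinimal_degree hgI hg0 (h ▸ hvm)
    · by_contra hsm
      obtain ⟨p, hp, hps⟩ := hdiv s hsm
      refine hG.reduced g hg p hp ?_ _ (ord.degree_mem_support hg0) (hps.trans hs.le)
      rintro rfl
      exact hps.not_gt hs
  refine ⟨_, v, hred, ?_⟩
  by_contra hne
  obtain ⟨d, hd, hdm⟩ := exists_mem_support_not_isFiberMinimal (ord := ord)
    (sub_mem hgI (binomial_mem_toricIdeal hred.2.1)) (sub_ne_zero.2 hne)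
  have hdu : d ≠ ord.degree g := by
    rintro rfl
    rw [mem_support_iff] at hd
    apply hd
    have h1 : coeff (ord.degree g) g = 1 := hG.monic g hg
    simp [h1, coeff_monomial, hred.1.symm]
  have hdv : d ≠ v := by
    rintro rfl
    exact hdm hvm
  have hdg : d ∈ g.support := by
    rw [mem_support_iff] at hd ⊢
    simpa [coeff_monomial, hdu.symm, hdv.symm] using hd
  obtain ⟨p, hp, hpd⟩ := hdiv d hdm
  by_cases hpg : p = g
  · subst hpg
    exact hdu (ord.toSyn.injective (le_antisymm (ord.le_degree hdg) (ord.toSyn_monotone hpd)))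
  · exact hG.reduced g hg p hp hpg d hdg hpd

end Groebner

theorem mem_universalGroebnerBasis_iff {σ : Type u} {K : Type*} [Field K] {a : σ → ℕ}
    {f : MvPolynomial σ K} :
    f ∈ universalGroebnerBasis (toricIdeal K a) ↔
      ∃ (ord : MonomialOrder.{u, u} σ) (u v : σ →₀ ℕ), IsReducedPair ord a u v ∧
        f = monomial u 1 - monomial v 1 :=
  ⟨fun ⟨ord, _, hG, hf⟩ => ⟨ord, hG.exists_isReducedPair hf⟩,
    fun ⟨ord, h⟩ => ⟨ord, _, isReducedGroebnerBasis_toricIdeal ord a, h⟩⟩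

/-- In a binomial of the universal Gröbner basis, the proper divisors of a monomial have pairwise
distinct weights. -/
theorem eq_of_lt_of_mem_universalGroebnerBasis {σ : Type u} {K : Type*} [Field K] {a : σ → ℕ}
    {u v s t : σ →₀ ℕ} (huv : u ≠ v)
    (h : (monomial u 1 - monomial v 1 : MvPolynomial σ K) ∈
      universalGroebnerBasis (toricIdeal K a))
    (hs : s < u) (ht : t < u) (hst : Finsupp.weight a s = Finsupp.weight a t) : s = t := by
  obtain ⟨ord, x, y, hxy, heq⟩ := mem_universalGroebnerBasis_iff.1 h
  have key : ∀ z < u, IsFiberMinimal ord a z := by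
    rcases binomial_eq_binomial huv heq with ⟨rfl, rfl⟩ | ⟨rfl, rfl⟩
    · exact hxy.2.2.2
    · exact fun z hz => hxy.2.2.1.of_le hz.le
  exact (key s hs).eq (key t ht) hst

/-! ### Circuits belong to the universal Gröbner basis. -/

section Circuits

/-- A term order in which `x i` and `x j` are the two smallest variables, and which compares
monomials in these two variables lexicographically. -/
theorem exists_monomialOrder_elimination {m : ℕ} {i j : Fin m} (hij : i ≠ j) :
    ∃ ord : MonomialOrder.{0, 0} (Fin m), ∀ u v : Fin m →₀ ℕ, (∀ k, k ≠ i → k ≠ j → u k = 0) →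
      ord.toSyn v < ord.toSyn u →
        (∀ k, k ≠ i → k ≠ j → v k = 0) ∧ v i ≤ u i ∧ (v i = u i → v j < u j) := by
  have hm : 2 ≤ m := by
    have := i.2; have := j.2; have := Fin.val_ne_of_ne hij; omega
  -- In the lexicographic order the last positions are the smallest variables, so `i` and `j` are
  -- moved to `m - 2` and `m - 1`.
  obtain ⟨e, hei, hej⟩ : ∃ e : Equiv.Perm (Fin m), (e i : ℕ) = m - 2 ∧ (e j : ℕ) = m - 1 := by
    let x : Fin m := ⟨m - 2, by omega⟩
    let y : Fin m := ⟨m - 1, by omega⟩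
    have hxy : x ≠ y := by simp [x, y, Fin.ext_iff]; omega
    have hx : Equiv.swap i x j ≠ x := by
      conv_rhs => rw [← Equiv.swap_apply_left i x]
      exact fun h => hij ((Equiv.swap i x).injective h).symm
    refine ⟨(Equiv.swap i x).trans (Equiv.swap (Equiv.swap i x j) y), ?_, ?_⟩
    · rw [Equiv.trans_apply, Equiv.swap_apply_left, Equiv.swap_apply_of_ne_of_ne hx.symm hxy]
    · rw [Equiv.trans_apply, Equiv.swap_apply_left]
  refine ⟨{ MonomialOrder.lex (σ := Fin m) with
    toSyn := (Finsupp.domCongr e).trans (MonomialOrder.lex (σ := Fin m)).toSyn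
    toSyn_monotone := fun u v huv => by
      have h : Finsupp.domCongr e u ≤ Finsupp.domCongr e v := fun k => by
        simpa using huv (e.symm k)
      exact (MonomialOrder.lex (σ := Fin m)).toSyn_monotone h }, fun u v hu hlt => ?_⟩
  have hlt' : toLex (Finsupp.domCongr e v) < toLex (Finsupp.domCongr e u) := hlt
  rw [Finsupp.Lex.lt_iff] at hlt'
  obtain ⟨k, hk, hklt⟩ := hlt'
  obtain ⟨k, rfl⟩ := e.surjective k
  have hagree : ∀ l, (e l : ℕ) < e k → v l = u l := fun l hl => by simpa using hk (e l) hl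
  have hklt' : v k < u k := by simpa using hklt
  have hsmall : ∀ l, l ≠ i → l ≠ j → (e l : ℕ) < m - 2 := fun l hi hj => by
    have h1 : (e l : ℕ) ≠ e i := fun h => hi (e.injective (Fin.ext h))
    have h2 : (e l : ℕ) ≠ e j := fun h => hj (e.injective (Fin.ext h))
    have := (e l).2
    omega
  by_cases hki : k = i
  · subst hki
    exact ⟨fun l hi hj => (hagree l (hei ▸ hsmall l hi hj)).trans (hu l hi hj), hklt'.le,
      fun h => absurd h hklt'.ne⟩
  by_cases hkj : k = j
  · subst hkj
    have hlt2 : (e i : ℕ) < e k := by omega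
    exact ⟨fun l hi hj => (hagree l ((hsmall l hi hj).trans (hei ▸ hlt2))).trans (hu l hi hj),
      (hagree i hlt2).le, fun _ => hklt'⟩
  · rw [hu k hki hkj] at hklt'
    exact absurd hklt' (Nat.not_lt_zero _)

theorem weight_single_eq {σ : Type*} (a : σ → ℕ) (i : σ) (n : ℕ) :
    Finsupp.weight a (Finsupp.single i n) = n * a i := by
  rw [Finsupp.weight_single, smul_eq_mul]

theorem weight_single_div {σ : Type*} {a : σ → ℕ} {i : σ} {n : ℕ} (h : a i ∣ n) :
    Finsupp.weight a (Finsupp.single i (n / a i)) = n := by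
  rw [weight_single_eq, Nat.div_mul_cancel h]

theorem weight_eq_of_support_subset_pair {σ : Type*} (a : σ → ℕ) {i j : σ} (hij : i ≠ j)
    {u : σ →₀ ℕ} (h : ∀ k, k ≠ i → k ≠ j → u k = 0) :
    Finsupp.weight a u = u i * a i + u j * a j := by
  classical
  have : u = Finsupp.single i (u i) + Finsupp.single j (u j) := by
    ext k
    by_cases hi : k = i
    · subst hi; simp [hij.symm]
    by_cases hj : k = j
    · subst hj; simp [hij]
    simp [h k hi hj, Ne.symm hi, Ne.symm hj]
  conv_lhs => rw [this]
  rw [map_add, weight_single_eq, weight_single_eq]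

/-- The binomial `x i ^ c - x j ^ d` with coprime exponents and monomials of the same weight. -/
noncomputable def circuit {σ : Type*} (K : Type*) [Field K] (a : σ → ℕ) (i j : σ) :
    MvPolynomial σ K :=
  monomial (Finsupp.single i ((a i).lcm (a j) / a i)) 1 -
    monomial (Finsupp.single j ((a i).lcm (a j) / a j)) 1

variable {m : ℕ} {K : Type*} [Field K] {a : Fin m → ℕ}

theorem lcm_div_pos_left (ha : ∀ i, 0 < a i) (i j : Fin m) : 0 < (a i).lcm (a j) / a i :=
  Nat.div_pos (Nat.le_of_dvd (Nat.lcm_pos (ha i) (ha j)) (Nat.dvd_lcm_left _ _)) (ha i)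

theorem lcm_div_pos_right (ha : ∀ i, 0 < a i) (i j : Fin m) : 0 < (a i).lcm (a j) / a j := by
  rw [Nat.lcm_comm]
  exact lcm_div_pos_left ha j i

theorem single_lcm_div_ne (ha : ∀ i, 0 < a i) {i j : Fin m} (hij : i ≠ j) :
    Finsupp.single i ((a i).lcm (a j) / a i) ≠ Finsupp.single j ((a i).lcm (a j) / a j) := by
  intro h
  have h1 := DFunLike.congr_fun h i
  rw [Finsupp.single_eq_same, Finsupp.single_eq_of_ne hij] at h1
  exact (lcm_div_pos_left ha i j).ne' h1

theorem circuit_mem_universalGroebnerBasis (ha : ∀ i, 0 < a i) {i j : Fin m} (hij : i ≠ j) :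
    circuit K a i j ∈ universalGroebnerBasis (toricIdeal K a) := by
  obtain ⟨ord, hord⟩ := exists_monomialOrder_elimination hij
  refine mem_universalGroebnerBasis_iff.2 ⟨ord, _, _, ⟨single_lcm_div_ne ha hij, ?_, ?_, ?_⟩, rfl⟩
  · rw [weight_single_div (Nat.dvd_lcm_left _ _), weight_single_div (Nat.dvd_lcm_right _ _)]
  all_goals
    -- Anything below `u` in this order also involves only `x i` and `x j`. With equal weight, it
    -- must have a smaller exponent at `i`.
    have key : ∀ u : Fin m →₀ ℕ, (∀ k, k ≠ i → k ≠ j → u k = 0) →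
        (∀ n, n < u i → ∀ l, n * a i + l * a j ≠ u i * a i + u j * a j) →
        IsFiberMinimal ord a u := by
      intro u hu hn v hw
      by_contra hlt
      obtain ⟨hv, hle, hji⟩ := hord u v hu (not_le.1 hlt)
      rw [weight_eq_of_support_subset_pair a hij hu,
        weight_eq_of_support_subset_pair a hij hv] at hw
      rcases hle.lt_or_eq with h | h
      · exact hn _ h _ hw
      · have h2 := hji h
        rw [h, Nat.add_left_cancel_iff] at hw
        exact h2.ne (Nat.eq_of_mul_eq_mul_right (ha j) hw)
  · refine key _ (fun k _ hj => Finsupp.single_eq_of_ne hj) fun n hn => ?_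
    rw [Finsupp.single_eq_of_ne hij] at hn
    exact absurd hn (Nat.not_lt_zero _)
  · intro s hs
    have hs0 : ∀ k, k ≠ i → s k = 0 := fun k hk => by
      have := hs.le k
      rw [Finsupp.single_eq_of_ne hk] at this
      exact Nat.le_zero.1 this
    have hsi : s i < (a i).lcm (a j) / a i := by
      by_contra hge
      refine hs.not_ge fun k => ?_
      by_cases hk : k = i
      · subst hk; simpa using hge
      · rw [Finsupp.single_eq_of_ne hk]; exact Nat.zero_le _
    refine key s (fun k hi _ => hs0 k hi) fun n hn l heq => ?_
    rw [hs0 j hij.symm, zero_mul, add_zero] at heq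
    -- A smaller exponent `n` would make `(s i - n) * a i` a positive common multiple below the lcm.
    have h1 : l * a j = (s i - n) * a i := by
      rw [Nat.sub_mul]; omega
    have h2 : (a i).lcm (a j) ∣ (s i - n) * a i :=
      Nat.lcm_dvd (Dvd.intro_left _ rfl) (h1 ▸ Dvd.intro_left _ rfl)
    have h3 := Nat.le_of_dvd (Nat.mul_pos (by omega) (ha i)) h2
    have h4 : (s i - n) * a i < (a i).lcm (a j) / a i * a i :=
      Nat.mul_lt_mul_of_pos_right (by omega) (ha i)
    rw [Nat.div_mul_cancel (Nat.dvd_lcm_left _ _)] at h4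
    omega

end Circuits

/-! ### Equal pairwise lcms force all Gröbner binomials into one weight. -/

section UniqueBetti

variable {m : ℕ} {a : Fin m → ℕ}

theorem weight_eq_sum (u : Fin m →₀ ℕ) : Finsupp.weight a u = ∑ i, u i * a i := by
  rw [Finsupp.weight_apply, Finsupp.sum_fintype _ _ (by simp)]
  simp

theorem div_dvd_of_lcm_eq (ha : ∀ i, 0 < a i) {b : ℕ} {i l : Fin m}
    (hb : (a i).lcm (a l) = b) : b / a i ∣ a l := by
  have h1 := Nat.gcd_mul_lcm (a i) (a l)
  have h2 : b / a i * a i = b := Nat.div_mul_cancel (hb ▸ Nat.dvd_lcm_left _ _)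
  rw [hb, ← h2, ← mul_assoc, mul_comm (a i)] at h1
  exact ⟨_, ((Nat.eq_of_mul_eq_mul_right (ha i) h1).symm.trans (mul_comm _ _))⟩

/-- Let `x_k^(b / a k)` be the smallest pure power of weight `b`; the others are nonstandard. If one
of them divides `x^u`, it equals `x^u` by minimality, so the weight is `b`. Otherwise, for `i ≠ k`,
both `u i` and `v i` are below `b / a i`. That number divides every other `a l` and is coprime to `a
i`, so it divides `u i - v i`. Hence `u` and `v` agree off `k`, and then everywhere, a
contradiction. -/
theorem IsReducedPair.weight_eq_of_lcm_eq (ha : ∀ i, 0 < a i) [Nontrivial (Fin m)]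
    (hgcd : ∀ d, (∀ i, d ∣ a i) → d = 1) {b : ℕ}
    (hb : ∀ i j, i ≠ j → (a i).lcm (a j) = b) {ord : MonomialOrder (Fin m)} {u v : Fin m →₀ ℕ}
    (h : IsReducedPair ord a u v) : Finsupp.weight a u = b := by
  have hdvd : ∀ i, a i ∣ b := fun i => by
    obtain ⟨j, hj⟩ := exists_ne i
    exact hb i j hj.symm ▸ Nat.dvd_lcm_left _ _
  have hbpos : 0 < b := by
    obtain ⟨i, j, hij⟩ := exists_pair_ne (Fin m)
    exact hb i j hij ▸ Nat.lcm_pos (ha i) (ha j)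
  have hcpos : ∀ i, 0 < b / a i := fun i => Nat.div_pos (Nat.le_of_dvd hbpos (hdvd i)) (ha i)
  obtain ⟨k, hk⟩ := Finite.exists_min fun i => ord.toSyn (Finsupp.single i (b / a i))
  have hnot : ∀ i, i ≠ k → ¬ IsFiberMinimal ord a (Finsupp.single i (b / a i)) := by
    intro i hik hmin
    have hw : Finsupp.weight a (Finsupp.single k (b / a k)) =
        Finsupp.weight a (Finsupp.single i (b / a i)) := by
      rw [weight_single_div (hdvd _), weight_single_div (hdvd _)]
    refine (hmin.lt hw fun heq => ?_).not_ge (hk i)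
    have := DFunLike.congr_fun heq i
    rw [Finsupp.single_eq_same, Finsupp.single_eq_of_ne hik] at this
    exact (hcpos i).ne this
  by_cases hdiv : ∃ i, i ≠ k ∧ b / a i ≤ u i
  · obtain ⟨i, hik, hi⟩ := hdiv
    rcases (Finsupp.single_le_iff.2 hi).eq_or_lt with heq | hlt
    · rw [← heq, weight_single_div (hdvd i)]
    · exact absurd (h.2.2.2 _ hlt) (hnot i hik)
  push Not at hdiv
  have hv : ∀ i, i ≠ k → v i < b / a i := fun i hik => by
    by_contra hge
    exact hnot i hik (h.2.2.1.of_le (Finsupp.single_le_iff.2 (not_lt.1 hge)))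
  have hsum : ∑ l, ((u l : ℤ) - v l) * a l = 0 := by
    have := h.2.1
    rw [weight_eq_sum, weight_eq_sum] at this
    simp_rw [sub_mul, Finset.sum_sub_distrib]
    rw [sub_eq_zero]
    exact_mod_cast this
  have heq : ∀ i, i ≠ k → u i = v i := by
    intro i hik
    have hcop : Nat.Coprime (b / a i) (a i) := hgcd _ fun l => by
      by_cases hl : l = i
      · exact hl ▸ Nat.gcd_dvd_right _ _
      · exact (Nat.gcd_dvd_left _ _).trans (div_dvd_of_lcm_eq ha (hb i l (Ne.symm hl)))
    have h1 : ((b / a i : ℕ) : ℤ) ∣ ((u i : ℤ) - v i) * a i := by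
      rw [← Finset.add_sum_erase _ _ (Finset.mem_univ i)] at hsum
      rw [eq_neg_of_add_eq_zero_left hsum, dvd_neg]
      refine Finset.dvd_sum fun l hl => Dvd.dvd.mul_left (Int.natCast_dvd_natCast.2 ?_) _
      exact div_dvd_of_lcm_eq ha (hb i l (Finset.ne_of_mem_erase hl).symm)
    have h2 := (Nat.isCoprime_iff_coprime.2 hcop).dvd_of_dvd_mul_right h1
    have h3 := hdiv i hik
    have h4 := hv i hik
    have := Int.eq_zero_of_abs_lt_dvd h2 (by rw [abs_lt]; constructor <;> omega)
    omega
  refine absurd ?_ h.1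
  ext i
  by_cases hik : i = k
  · subst hik
    rw [← Finset.add_sum_erase _ _ (Finset.mem_univ i), Finset.sum_eq_zero, add_zero] at hsum
    · have hai := ha i
      rcases mul_eq_zero.1 hsum with h' | h' <;> omega
    · intro l hl
      rw [heq l (Finset.ne_of_mem_erase hl), sub_self, zero_mul]
  · exact heq i hik

end UniqueBetti

/-! ### Both implications for generators with gcd 1. -/

section Robust

variable {m : ℕ} {K : Type*} [Field K] {a : Fin m → ℕ}

theorem monomial_mem_idealOfVars {σ : Type*} {t : σ →₀ ℕ} (ht : t ≠ 0) (c : K) :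
    monomial t c ∈ idealOfVars σ K := by
  classical
  rw [mem_idealOfVars_iff, coeff_monomial, if_neg ht]

theorem binomial_add_mem_idealOfVars_mul {σ : Type*} {a : σ → ℕ} {t u v : σ →₀ ℕ} (ht : t ≠ 0)
    (h : Finsupp.weight a u = Finsupp.weight a v) :
    (monomial (t + u) 1 - monomial (t + v) 1 : MvPolynomial σ K) ∈
      idealOfVars σ K * toricIdeal K a := by
  have := Ideal.mul_mem_mul (monomial_mem_idealOfVars ht (1 : K)) (binomial_mem_toricIdeal h)
  rwa [mul_sub, monomial_mul, monomial_mul, one_mul] at this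

theorem binomial_mem_idealOfVars_mul_of_common {σ : Type*} {a : σ → ℕ} {u v : σ →₀ ℕ} {i : σ}
    (hu : u i ≠ 0) (hv : v i ≠ 0) (h : Finsupp.weight a u = Finsupp.weight a v) :
    (monomial u 1 - monomial v 1 : MvPolynomial σ K) ∈ idealOfVars σ K * toricIdeal K a := by
  obtain ⟨s, rfl⟩ := exists_add_of_le
    (Finsupp.single_le_iff.2 (Nat.one_le_iff_ne_zero.2 hu) : Finsupp.single i 1 ≤ u)
  obtain ⟨t, rfl⟩ := exists_add_of_le
    (Finsupp.single_le_iff.2 (Nat.one_le_iff_ne_zero.2 hv) : Finsupp.single i 1 ≤ v)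
  refine binomial_add_mem_idealOfVars_mul (by simp) ?_
  rwa [map_add, map_add, Nat.add_left_cancel_iff] at h

/-- The monomial obtained from `x i ^ (n / a i)` by trading a power of `x i` for a power of `x j`
along the circuit of `i` and `j`. -/
noncomputable def exchange (a : Fin m → ℕ) (i j : Fin m) (n : ℕ) : Fin m →₀ ℕ :=
  Finsupp.single i (n / a i - (a i).lcm (a j) / a i) +
    Finsupp.single j ((a i).lcm (a j) / a j)

theorem exchange_apply_right_ne_zero (ha : ∀ i, 0 < a i) (i j : Fin m) (n : ℕ) :
    exchange a i j n j ≠ 0 := by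
  have := lcm_div_pos_right ha i j
  simp only [exchange, Finsupp.add_apply, Finsupp.single_eq_same]
  omega

theorem single_eq_add_single {i j : Fin m} {n : ℕ} (hn : (a i).lcm (a j) ≤ n) :
    Finsupp.single i (n / a i) = Finsupp.single i (n / a i - (a i).lcm (a j) / a i) +
      Finsupp.single i ((a i).lcm (a j) / a i) := by
  rw [← Finsupp.single_add, Nat.sub_add_cancel (Nat.div_le_div_right hn)]

theorem weight_exchange {i j : Fin m} {n : ℕ} (hi : a i ∣ n) (hn : (a i).lcm (a j) ≤ n) :
    Finsupp.weight a (exchange a i j n) = n := by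
  conv_rhs => rw [← weight_single_div hi, single_eq_add_single hn]
  rw [exchange, map_add, map_add, weight_single_div (Nat.dvd_lcm_left _ _),
    weight_single_div (Nat.dvd_lcm_right _ _)]

theorem single_sub_exchange_mem {i j : Fin m} {n : ℕ} (hi : a i ∣ n)
    (hn : (a i).lcm (a j) < n) :
    (monomial (Finsupp.single i (n / a i)) 1 - monomial (exchange a i j n) 1 :
      MvPolynomial (Fin m) K) ∈ idealOfVars (Fin m) K * toricIdeal K a := by
  rw [single_eq_add_single hn.le, exchange]
  refine binomial_add_mem_idealOfVars_mul ?_ ?_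
  · have h1 : (a i).lcm (a j) / a i < n / a i := Nat.div_lt_div_of_lt_of_dvd hi hn
    rw [Ne, Finsupp.single_eq_zero]
    omega
  · rw [weight_single_div (Nat.dvd_lcm_left _ _), weight_single_div (Nat.dvd_lcm_right _ _)]

/-- Modulo `m * I`, both monomials of the circuit of `j` and `k` can be exchanged for monomials
divisible by `x i`. Those two share a variable, so they also agree modulo `m * I`. -/
theorem not_lcm_lt_and_lcm_lt (ha : ∀ i, 0 < a i) {i j k : Fin m}
    (hcirc : circuit K a j k ∉ idealOfVars (Fin m) K * toricIdeal K a) :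
    ¬ ((a i).lcm (a j) < (a j).lcm (a k) ∧ (a i).lcm (a k) < (a j).lcm (a k)) := by
  rintro ⟨h1, h2⟩
  rw [Nat.lcm_comm (a i)] at h1 h2
  apply hcirc
  have hj := single_sub_exchange_mem (K := K) (Nat.dvd_lcm_left (a j) (a k)) h1
  have hk := single_sub_exchange_mem (K := K) (Nat.dvd_lcm_right (a j) (a k)) h2
  have hc := binomial_mem_idealOfVars_mul_of_common (K := K) (a := a)
    (exchange_apply_right_ne_zero ha j i ((a j).lcm (a k)))
    (exchange_apply_right_ne_zero ha k i ((a j).lcm (a k)))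
    (by rw [weight_exchange (Nat.dvd_lcm_left _ _) h1.le,
      weight_exchange (Nat.dvd_lcm_right _ _) h2.le])
  have := Ideal.sub_mem _ (Ideal.add_mem _ hj hc) hk
  rw [circuit]
  convert this using 1
  ring

/-- Replacing `x_i^(n / a i)` by `exchange a i j n` changes the circuit of `i` and `k` only modulo
`m * I`, so the result is still a Markov binomial. But the exchanged monomial is properly divisible
by both monomials of the circuit of `i` and `j`, which no Gröbner binomial allows. -/
theorem not_lcm_lt_and_lcm_eq (ha : ∀ i, 0 < a i)
    (hrob : IsGeneralizedRobust (toricIdeal K a)) {i j k : Fin m} (hij : i ≠ j) (hjk : j ≠ k)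
    (hcirc : circuit K a i k ∉ idealOfVars (Fin m) K * toricIdeal K a) :
    ¬ ((a i).lcm (a j) < (a i).lcm (a k) ∧ (a i).lcm (a k) = (a j).lcm (a k)) := by
  rintro ⟨h1, h2⟩
  set n := (a i).lcm (a k) with hn
  have hin : a i ∣ n := Nat.dvd_lcm_left _ _
  have hkn : a k ∣ n := Nat.dvd_lcm_right _ _
  have hjn : a j ∣ n := h2 ▸ Nat.dvd_lcm_left _ _
  have hdvd : (a i).lcm (a j) ∣ n := Nat.lcm_dvd hin hjn
  have hne : exchange a i j n ≠ Finsupp.single k (n / a k) := fun h => by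
    have h' := DFunLike.congr_fun h j
    rw [Finsupp.single_eq_of_ne hjk] at h'
    exact exchange_apply_right_ne_zero ha i j n h'
  have hUM : (monomial (exchange a i j n) 1 - monomial (Finsupp.single k (n / a k)) 1 :
      MvPolynomial (Fin m) K) ∈ universalMarkovBasis (toricIdeal K a) := by
    refine (mem_universalMarkovBasis_iff ha).2 ⟨⟨_, _, hne, rfl⟩, binomial_mem_toricIdeal ?_,
      fun h => hcirc ?_⟩
    · rw [weight_exchange hin h1.le, weight_single_div hkn]
    · have := Ideal.add_mem _ (single_sub_exchange_mem (K := K) hin h1) h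
      rwa [sub_add_sub_cancel] at this
  rw [IsGeneralizedRobust] at hrob
  rw [← hrob] at hUM
  have hp := lcm_div_pos_left ha i j
  have hq := lcm_div_pos_right ha i j
  have hle : Finsupp.single i ((a i).lcm (a j) / a i) < exchange a i j n := by
    refine lt_of_le_of_ne (Finsupp.single_le_iff.2 ?_) fun h => ?_
    · obtain ⟨r, hr⟩ := hdvd
      have hr2 : 2 ≤ r := by
        by_contra hr2
        have : r = 0 ∨ r = 1 := by omega
        rcases this with rfl | rfl <;> omega
      have hdiv : n / a i = (a i).lcm (a j) / a i * r := by
        rw [hr, Nat.mul_comm, Nat.mul_div_assoc _ (Nat.dvd_lcm_left _ _), Nat.mul_comm]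
      have : (a i).lcm (a j) / a i * 2 ≤ n / a i := hdiv ▸ Nat.mul_le_mul_left _ hr2
      simp only [exchange, Finsupp.add_apply, Finsupp.single_eq_same,
        Finsupp.single_eq_of_ne hij]
      omega
    · refine exchange_apply_right_ne_zero ha i j n ?_
      rw [← h, Finsupp.single_eq_of_ne hij.symm]
  have hlt : Finsupp.single j ((a i).lcm (a j) / a j) < exchange a i j n := by
    refine lt_of_le_of_ne le_add_self fun h => ?_
    have h' := DFunLike.congr_fun h i
    have hpos : (a i).lcm (a j) / a i < n / a i := Nat.div_lt_div_of_lt_of_dvd hin h1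
    simp only [exchange, Finsupp.add_apply, Finsupp.single_eq_same,
      Finsupp.single_eq_of_ne hij] at h'
    omega
  refine single_lcm_div_ne ha hij
    (eq_of_lt_of_mem_universalGroebnerBasis hne hUM hle hlt ?_)
  rw [weight_single_div (Nat.dvd_lcm_left _ _), weight_single_div (Nat.dvd_lcm_right _ _)]

theorem circuit_mem_universalMarkovBasis (ha : ∀ i, 0 < a i)
    (hrob : IsGeneralizedRobust (toricIdeal K a)) {i j : Fin m} (hij : i ≠ j) :
    circuit K a i j ∈ universalMarkovBasis (toricIdeal K a) := by
  rw [← show universalGroebnerBasis _ = _ from hrob]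
  exact circuit_mem_universalGroebnerBasis ha hij

theorem exists_lcm_eq_of_isGeneralizedRobust (ha : ∀ i, 0 < a i) [Nontrivial (Fin m)]
    (hrob : IsGeneralizedRobust (toricIdeal K a)) :
    ∃ b, ∀ i j, i ≠ j → (a i).lcm (a j) = b := by
  have hcirc : ∀ i j, i ≠ j → circuit K a i j ∉ idealOfVars (Fin m) K * toricIdeal K a :=
    fun i j hij => ((mem_universalMarkovBasis_iff ha).1
      (circuit_mem_universalMarkovBasis ha hrob hij)).2.2
  have h3 : ∀ i j k, i ≠ j → i ≠ k → j ≠ k → (a i).lcm (a j) = (a i).lcm (a k) := by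
    intro i j k hij hik hjk
    -- `t1`–`t3` exclude a unique maximum of the three lcms; `t4`–`t6` exclude a unique minimum
    -- below two equal values.
    have t1 := not_lcm_lt_and_lcm_lt ha (i := i) (hcirc j k hjk)
    have t2 := not_lcm_lt_and_lcm_lt ha (i := j) (hcirc i k hik)
    have t3 := not_lcm_lt_and_lcm_lt ha (i := k) (hcirc i j hij)
    have t4 := not_lcm_lt_and_lcm_eq ha hrob hij hjk (hcirc i k hik)
    have t5 := not_lcm_lt_and_lcm_eq ha hrob hik hjk.symm (hcirc i j hij)
    have t6 := not_lcm_lt_and_lcm_eq ha hrob hjk hik.symm (hcirc j i hij.symm)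
    rw [Nat.lcm_comm (a j) (a i)] at t2 t6
    rw [Nat.lcm_comm (a k) (a i), Nat.lcm_comm (a k) (a j)] at t3
    rw [Nat.lcm_comm (a k) (a j)] at t5
    rw [Nat.lcm_comm (a k) (a i)] at t6
    omega
  obtain ⟨x, y, hxy⟩ := exists_pair_ne (Fin m)
  have hx : ∀ j, x ≠ j → (a x).lcm (a j) = (a x).lcm (a y) := fun j hj => by
    by_cases hjy : j = y
    · rw [hjy]
    · exact h3 x j y hj hxy hjy
  refine ⟨(a x).lcm (a y), fun i j hij => ?_⟩
  by_cases hi : x = i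
  · exact hi ▸ hx j (hi ▸ hij)
  rw [← hx i hi, Nat.lcm_comm (a x)]
  by_cases hj : j = x
  · rw [hj]
  · exact h3 i j x hij (Ne.symm hi) hj

theorem weight_eq_of_isWeightedHomogeneous_binomial {u v : Fin m →₀ ℕ} (huv : u ≠ v) {n : ℕ}
    (h : IsWeightedHomogeneous a (monomial u 1 - monomial v 1 : MvPolynomial (Fin m) K) n) :
    Finsupp.weight a u = n ∧ Finsupp.weight a v = n := by
  classical
  constructor <;>
  · refine h (mem_support_iff.1 ?_)
    simp [support_binomial huv]

theorem hasUniqueBettiElement_of_isGeneralizedRobust (ha : ∀ i, 0 < a i) [Nontrivial (Fin m)]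
    (hgcd : ∀ d, (∀ i, d ∣ a i) → d = 1) (hrob : IsGeneralizedRobust (toricIdeal K a)) :
    HasUniqueBettiElement K a := by
  obtain ⟨b, hb⟩ := exists_lcm_eq_of_isGeneralizedRobust ha hrob
  obtain ⟨i, j, hij⟩ := exists_pair_ne (Fin m)
  refine ⟨b, ?_, ?_⟩
  · obtain ⟨B, hB, hmem⟩ := circuit_mem_universalMarkovBasis ha hrob hij
    refine ⟨B, hB, _, hmem, isWeightedHomogeneous_binomial ?_ ?_⟩
    · rw [weight_single_div (Nat.dvd_lcm_left _ _), hb i j hij]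
    · rw [weight_single_div (Nat.dvd_lcm_right _ _), hb i j hij]
  · rintro b' ⟨B, hB, f, hf, hhom⟩
    have hfU : f ∈ universalGroebnerBasis (toricIdeal K a) := by
      rw [show universalGroebnerBasis _ = _ from hrob]
      exact ⟨B, hB, hf⟩
    obtain ⟨ord, u, v, h, rfl⟩ := mem_universalGroebnerBasis_iff.1 hfU
    rw [← (weight_eq_of_isWeightedHomogeneous_binomial h.1 hhom).1]
    exact h.weight_eq_of_lcm_eq ha hgcd hb

theorem toricIdeal_le_of_isMarkovBasis {b : ℕ} {B : Set (MvPolynomial (Fin m) K)}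
    (hB : IsMarkovBasis (toricIdeal K a) B) (hb : ∀ f ∈ B, IsWeightedHomogeneous a f b) :
    toricIdeal K a ≤
      Ideal.span ((fun s => monomial s (1 : K)) '' {s | Finsupp.weight a s = b}) := by
  rw [← hB.1.2, Ideal.span_le]
  intro f hf
  exact mem_ideal_span_monomial_image.2 fun d hd => ⟨d, hb f hf (mem_support_iff.1 hd), le_rfl⟩

/-- Multiplying by a variable strictly raises the weight, so every monomial occurring in `m * I` has
weight above `b`. -/
theorem notMem_idealOfVars_mul_of_weight_eq (ha : ∀ i, 0 < a i) {b : ℕ}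
    (hI : toricIdeal K a ≤
      Ideal.span ((fun s => monomial s (1 : K)) '' {s | Finsupp.weight a s = b}))
    {f : MvPolynomial (Fin m) K} {d : Fin m →₀ ℕ} (hd : d ∈ f.support)
    (hw : Finsupp.weight a d = b) : f ∉ idealOfVars (Fin m) K * toricIdeal K a := by
  intro hf
  have hle : idealOfVars (Fin m) K * toricIdeal K a ≤
      Ideal.span ((fun s => monomial s (1 : K)) '' {s | b < Finsupp.weight a s}) := by
    refine (Ideal.mul_mono_right hI).trans ?_
    rw [idealOfVars, Ideal.span_mul_span', Ideal.span_le]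
    rintro _ ⟨_, ⟨i, rfl⟩, _, ⟨s, hs, rfl⟩, rfl⟩
    refine Ideal.subset_span ⟨Finsupp.single i 1 + s, ?_, ?_⟩
    · have := ha i
      have hs' : Finsupp.weight a s = b := hs
      simp only [Set.mem_ofPred_eq, map_add, weight_single_eq, hs']
      omega
    · simp [X, monomial_mul]
  obtain ⟨s, hs, hsd⟩ := mem_ideal_span_monomial_image.1 (hle hf) d hd
  obtain ⟨t, rfl⟩ := exists_add_of_le hsd
  have hs' : b < Finsupp.weight a s := hs
  rw [map_add] at hw
  omega

theorem isGeneralizedRobust_of_hasUniqueBettiElement (ha : ∀ i, 0 < a i) [Nontrivial (Fin m)]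
    (hgcd : ∀ d, (∀ i, d ∣ a i) → d = 1) (h : HasUniqueBettiElement K a) :
    IsGeneralizedRobust (toricIdeal K a) := by
  classical
  obtain ⟨b, ⟨B, hB, f, hfB, hf⟩, huniq⟩ := h
  have hUM : ∀ g ∈ universalMarkovBasis (toricIdeal K a), IsWeightedHomogeneous a g b := by
    rintro g ⟨D, hD, hg⟩
    obtain ⟨n, hn⟩ := exists_weight_of_isBinomial_of_mem (hD.1.1 g hg)
      (hD.1.2 ▸ Ideal.subset_span hg)
    exact huniq n ⟨D, hD, g, hg, hn⟩ ▸ hn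
  have hI := toricIdeal_le_of_isMarkovBasis hB fun g hg => hUM g ⟨B, hB, hg⟩
  have hdiv : ∀ {u v : Fin m →₀ ℕ}, u ≠ v → Finsupp.weight a u = Finsupp.weight a v →
      ∃ s, Finsupp.weight a s = b ∧ s ≤ u := fun {u v} huv hw => by
    obtain ⟨s, hs, hsu⟩ := mem_ideal_span_monomial_image.1
      (hI (binomial_mem_toricIdeal (K := K) hw)) u (by simp [support_binomial huv])
    exact ⟨s, hs, hsu⟩
  have hbpos : 0 < b := by
    obtain ⟨u, v, huv, rfl⟩ := hB.1.1 f hfB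
    obtain ⟨h1, h2⟩ := weight_eq_of_isWeightedHomogeneous_binomial huv hf
    by_contra hb0
    obtain rfl : b = 0 := by omega
    exact huv (((weight_eq_zero_iff ha).1 h1).trans ((weight_eq_zero_iff ha).1 h2).symm)
  -- A pure power with a companion in its fiber has a divisor of weight `b`, which is again a power
  -- of `x i`.
  have hpow : ∀ i n v, Finsupp.single i n ≠ v → n * a i = Finsupp.weight a v →
      a i ∣ b ∧ b ≤ n * a i := by
    intro i n v hne hw
    obtain ⟨s, hs, hsu⟩ := hdiv hne (by rw [weight_single_eq, hw])
    have hsi : s = Finsupp.single i (s i) := by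
      ext k
      by_cases hk : k = i
      · subst hk; simp
      · have := hsu k
        rw [Finsupp.single_eq_of_ne hk] at this ⊢
        exact Nat.le_zero.1 this
    rw [hsi, weight_single_eq] at hs
    refine ⟨Dvd.intro_left _ hs, hs ▸ Nat.mul_le_mul_right _ ?_⟩
    simpa using hsu i
  have hlcm : ∀ i j, i ≠ j → (a i).lcm (a j) = b := by
    intro i j hij
    have hi := hpow i _ _ (single_lcm_div_ne ha hij) (by
      rw [Nat.div_mul_cancel (Nat.dvd_lcm_left _ _), weight_single_div (Nat.dvd_lcm_right _ _)])
    have hj := hpow j _ _ (single_lcm_div_ne ha hij).symm (by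
      rw [Nat.div_mul_cancel (Nat.dvd_lcm_right _ _), weight_single_div (Nat.dvd_lcm_left _ _)])
    rw [Nat.div_mul_cancel (Nat.dvd_lcm_left _ _)] at hi
    exact le_antisymm (Nat.le_of_dvd hbpos (Nat.lcm_dvd hi.1 hj.1)) hi.2
  have hdvd : ∀ i, a i ∣ b := fun i => by
    obtain ⟨j, hj⟩ := exists_ne i
    exact hlcm i j hj.symm ▸ Nat.dvd_lcm_left _ _
  -- A monomial of weight `b` containing `x i` shares that variable with `x_i^(b / a i)`. If they
  -- differed, their difference would be a weight `b` element of `m * I`.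
  have hfiber : ∀ u, Finsupp.weight a u = b → ∃ i, u = Finsupp.single i (b / a i) := by
    intro u hu
    obtain ⟨i, hi⟩ : ∃ i, u i ≠ 0 := by
      by_contra! hall
      rw [show u = 0 from Finsupp.ext hall, map_zero] at hu
      omega
    refine ⟨i, ?_⟩
    by_contra hne
    have hci : b / a i ≠ 0 := (Nat.div_pos (Nat.le_of_dvd hbpos (hdvd i)) (ha i)).ne'
    refine notMem_idealOfVars_mul_of_weight_eq
      (f := monomial u 1 - monomial (Finsupp.single i (b / a i)) 1) (d := u) ha hI
      (by simp [support_binomial hne]) hu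
      (binomial_mem_idealOfVars_mul_of_common hi (by rwa [Finsupp.single_eq_same]) ?_)
    rw [hu, weight_single_div (hdvd i)]
  refine Set.Subset.antisymm (fun g hg => ?_) (fun g hg => ?_)
  · obtain ⟨ord, u, v, hp, rfl⟩ := mem_universalGroebnerBasis_iff.1 hg
    refine (mem_universalMarkovBasis_iff ha).2 ⟨⟨u, v, hp.1, rfl⟩, binomial_mem_toricIdeal hp.2.1,
      notMem_idealOfVars_mul_of_weight_eq (d := u) ha hI (by simp [support_binomial hp.1])
        (hp.weight_eq_of_lcm_eq ha hgcd hlcm)⟩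
  · obtain ⟨⟨u, v, huv, rfl⟩, -, -⟩ := (mem_universalMarkovBasis_iff ha).1 hg
    obtain ⟨hu, hv⟩ := weight_eq_of_isWeightedHomogeneous_binomial huv (hUM _ hg)
    obtain ⟨i, rfl⟩ := hfiber u hu
    obtain ⟨j, rfl⟩ := hfiber v hv
    have hij : i ≠ j := by
      rintro rfl
      exact huv rfl
    have := circuit_mem_universalGroebnerBasis (K := K) ha hij
    rwa [circuit, hlcm i j hij] at this

end Robust

/-! ### Positivity, gcd and number of generators of a numerical semigroup. -/

section NumericalSemigroup

variable {S : AddSubmonoid ℕ} {m : ℕ} {a : Fin m → ℕ}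

theorem IsMinimalGeneratingSet.pos (hmin : IsMinimalGeneratingSet S (Set.range a)) (i : Fin m) :
    0 < a i := by
  refine Nat.pos_of_ne_zero fun h => ?_
  have h1 : AddSubmonoid.closure (Set.range a \ {0}) = S := by
    rw [AddSubmonoid.closure_sdiff_singleton_zero, hmin.1]
  exact (hmin.2 h1 Set.sdiff_subset ⟨i, rfl⟩).2 h

theorem IsNumericalSemigroup.eq_one_of_forall_dvd (hS : IsNumericalSemigroup S)
    (hgen : AddSubmonoid.closure (Set.range a) = S) {d : ℕ} (hd : ∀ i, d ∣ a i) : d = 1 := by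
  have hdS : ∀ n ∈ S, d ∣ n := by
    intro n hn
    rw [← hgen] at hn
    induction hn using AddSubmonoid.closure_induction with
    | mem x hx => obtain ⟨i, rfl⟩ := hx; exact hd i
    | zero => exact dvd_zero d
    | add x y _ _ hx hy => exact dvd_add hx hy
  obtain ⟨N, hN⟩ := Set.Finite.bddAbove hS
  have hmem : ∀ n, N < n → n ∈ S := fun n hn => by
    by_contra h
    exact hn.not_ge (hN h)
  -- Cofiniteness gives two consecutive elements of `S`, both divisible by `d`.
  exact Nat.dvd_one.1 ((Nat.dvd_add_right (hdS _ (hmem (N + 1) (by omega)))).1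
    (hdS _ (hmem (N + 1 + 1) (by omega))))

theorem IsNumericalSemigroup.nontrivial_fin (hS : IsNumericalSemigroup S) (hne : S ≠ ⊤)
    (hgen : AddSubmonoid.closure (Set.range a) = S) : Nontrivial (Fin m) := by
  by_contra htriv
  rw [not_nontrivial_iff_subsingleton] at htriv
  have hone : ∃ i, a i = 1 := by
    by_contra! h1
    rcases isEmpty_or_nonempty (Fin m) with hem | ⟨⟨i⟩⟩
    · exact absurd (hS.eq_one_of_forall_dvd hgen (d := 2) fun i => hem.elim i) (by decide)
    · exact h1 i (hS.eq_one_of_forall_dvd hgen fun j => by rw [Subsingleton.elim i j])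
  obtain ⟨i, hi⟩ := hone
  refine hne (top_unique ?_)
  rw [← Nat.addSubmonoidClosure_one, ← hgen]
  exact AddSubmonoid.closure_mono (by rintro _ rfl; exact ⟨i, hi⟩)

end NumericalSemigroup

theorem theorem4p12 {K : Type*} [Field K] (S : AddSubmonoid ℕ) (hS : IsNumericalSemigroup S)
    (hne : S ≠ ⊤) {m : ℕ} (a : Fin m → ℕ) (ha : Function.Injective a)
    (hmin : IsMinimalGeneratingSet S (Set.range a)) :
    IsGeneralizedRobust (toricIdeal K a) ↔ HasUniqueBettiElement K a := by
  have := hS.nontrivial_fin hne hmin.1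
  exact ⟨hasUniqueBettiElement_of_isGeneralizedRobust hmin.pos
      fun _ => hS.eq_one_of_forall_dvd hmin.1,
    isGeneralizedRobust_of_hasUniqueBettiElement hmin.pos
      fun _ => hS.eq_one_of_forall_dvd hmin.1⟩
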